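/- **Theorem.** Let $\alpha_1,\dots,\alpha_M\in\mathbb R$, let $k_1,\dots,k_M$ be positive integers and let $m\in\mathbb N$. For operators $A_1,\dots,A_\Lambda$ on a finite-dimensional complex Hilbert space and $x\in\mathbb R$ put $$S_A(x):=e^{-i\frac x2A_1}\cdots e^{-i\frac x2A_\Lambda}\;e^{-i\frac x2A_\Lambda}\cdots e^{-i\frac x2A_1}$$ (the Strang, or midpoint, formula). Suppose that $(\alpha_j,k_j)_{j\le M}$ give a time-independent multi-product formula of order $2m$, that is: for every finite family $A_1,\dots,A_\Lambda$ of self-adjoint operators on every finite-dimensional complex Hilbert space, $$e^{-ix\sum_l A_l}=\sum_{j=1}^M\alpha_j\,\bigl(S_A(x/k_j)\bigr)^{k_j}+O(x^{2m+1})\qquad(x\to0^+).$$ Let $\mathcal H$ be a finite-dimensional complex Hilbert space, let $H_1,\dots,H_\Lambda$ be $C^\infty$ functions from $\mathbb R$ to the operators on $\mathcal H$ (in particular, they may be time-dependent Hamiltonians, that is, self-adjoint-valued), put $H(t)=\sum_l H_l(t)$, and let $$U(t,s)=\exp_{\mathcal T}\Bigl(-i\int_s^tH(r)\,dr\Bigr)=\sum_{n\ge0}(-i)^n\int_{s\le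 r_n\le\cdots\le r_1\le t}H(r_1)\cdots H(r_n)\,dr_n\cdots dr_1\qquad(s\le t)$$ be the exact evolution. Let $$U_2(t,s):=e^{-i\frac{t-s}2H_1(\frac{t+s}2)}\cdots e^{-i\frac{t-s}2H_\Lambda(\frac{t+s}2)}\;e^{-i\frac{t-s}2H_\Lambda(\frac{t+s}2)}\cdots e^{-i\frac{t-s}2H_1(\frac{t+s}2)}$$ be the time-dependent midpoint step. Then, as $\Delta t\to0^+$, $$U(t+\Delta t,t)=\sum_{j=1}^M\alpha_j\prod_{\ell=k_j-1}^{0}U_2\Bigl(t+\tfrac{(\ell+1)\Delta t}{k_j},\,t+\tfrac{\ell\,\Delta t}{k_j}\Bigr)+O(\Delta t^{2m+1}),$$ where in the product the factor with $\ell=k_j-1$ stands leftmost. The error bound is in operator norm and uniform for $t$ in any compact subset of $\mathbb R$. -/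

import Mathlib

open Complex Filter Topology
open scoped ContDiff

noncomputable section

namespace MPF

section Algebra

variable {𝔸 : Type*} [NormedRing 𝔸] [NormedAlgebra ℂ 𝔸]

/-- One step, of length `x`, of the time-independent midpoint (Strang) formula for
`∑ k, A k`, the factors being numbered from left to right:
`e^{-i x A₁ / 2} ⋯ e^{-i x A_Λ / 2} e^{-i x A_Λ / 2} ⋯ e^{-i x A₁ / 2}`. -/
def strang {Λ : ℕ} (A : Fin Λ → 𝔸) (x : ℝ) : 𝔸 :=
  (List.ofFn fun k => NormedSpace.exp ((-I * ((x / 2 : ℝ) : ℂ)) • A k)).prod *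
    (List.ofFn fun k => NormedSpace.exp ((-I * ((x / 2 : ℝ) : ℂ)) • A k)).reverse.prod

/-- The time-dependent midpoint step `U₂(t, s)` from time `s` to time `t`: the Strang step of
length `t - s` with all the Hamiltonians frozen at the midpoint `(t + s) / 2`. -/
def midpointStep {Λ : ℕ} (H : Fin Λ → ℝ → 𝔸) (t s : ℝ) : 𝔸 :=
  strang (fun k => H k ((t + s) / 2)) (t - s)

/-- The ordered product of `n` midpoint steps over the `n` equal subintervals of `[t, t + δ]`;
the factor of the last subinterval is the leftmost one. -/
def midpointProd {Λ : ℕ} (H : Fin Λ → ℝ → 𝔸) (n : ℕ) (t δ : ℝ) : 𝔸 :=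
  ((List.range n).reverse.map fun ℓ : ℕ =>
    midpointStep H (t + ((ℓ : ℝ) + 1) * δ / n) (t + (ℓ : ℝ) * δ / n)).prod

/-- The `n`-th term of the Dyson series,
`(-i)^n ∫_{s ≤ r_n ≤ ⋯ ≤ r_1 ≤ t} H(r_1) ⋯ H(r_n)`. -/
def dysonTerm (H : ℝ → 𝔸) (s : ℝ) : ℕ → ℝ → 𝔸
  | 0, _ => 1
  | n + 1, t => ∫ r in s..t, (-I) • (H r * dysonTerm H s n r)

/-- The time-ordered exponential `exp_T(-i ∫_s^t H(r) dr)`, as a Dyson series. -/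
def evolution (H : ℝ → 𝔸) (t s : ℝ) : 𝔸 :=
  ∑' n, dysonTerm H s n t

theorem hasDerivAt_dysonTerm_succ [CompleteSpace 𝔸] {H : ℝ → 𝔸} (hH : Continuous H) (s : ℝ) (n : ℕ) :
    ∀ t, HasDerivAt (dysonTerm H s (n + 1)) ((-I) • (H t * dysonTerm H s n t)) t := by
  induction n with
  | zero =>
    intro t
    have hc : Continuous fun r => (-I) • (H r * dysonTerm H s 0 r) := by
      simp only [dysonTerm]; fun_prop
    exact intervalIntegral.integral_hasDerivAt_right (hc.intervalIntegrable _ _)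
      hc.stronglyMeasurable.stronglyMeasurableAtFilter hc.continuousAt
  | succ n ih =>
    intro t
    have hD : Continuous (dysonTerm H s (n + 1)) :=
      continuous_iff_continuousAt.2 fun t => (ih t).continuousAt
    have hc : Continuous fun r => (-I) • (H r * dysonTerm H s (n + 1) r) := by fun_prop
    exact intervalIntegral.integral_hasDerivAt_right (hc.intervalIntegrable _ _)
      hc.stronglyMeasurable.stronglyMeasurableAtFilter hc.continuousAt

theorem norm_dysonTerm_le {H : ℝ → 𝔸} {a b s C : ℝ} (hs : s ∈ Set.Ioo a b)
    (hC : ∀ r ∈ Set.Ioo a b, ‖H r‖ ≤ C) (n : ℕ) :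
    ∀ t ∈ Set.Ioo a b, ‖dysonTerm H s n t‖ ≤ (C * |t - s|) ^ n / n.factorial * ‖(1 : 𝔸)‖ := by
  have hC0 : 0 ≤ C := (norm_nonneg _).trans (hC s hs)
  induction n with
  | zero => intro t _; simp [dysonTerm]
  | succ n ih =>
    intro t ht
    have hsub : Set.uIcc s t ⊆ Set.Ioo a b := Set.ordConnected_Ioo.uIcc_subset hs ht
    have hb : ∀ r ∈ Set.uIoc s t, ‖(-I) • (H r * dysonTerm H s n r)‖ ≤
        C * ((C * |r - s|) ^ n / n.factorial * ‖(1 : 𝔸)‖) := by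
      intro r hr
      have hr' := hsub (Set.uIoc_subset_uIcc hr)
      rw [norm_smul]
      simp only [norm_neg, Complex.norm_I, one_mul]
      exact (norm_mul_le _ _).trans
        (mul_le_mul (hC r hr') (ih r hr') (norm_nonneg _) hC0)
    have hcont : Continuous fun r : ℝ => C * ((C * |r - s|) ^ n / n.factorial * ‖(1 : 𝔸)‖) := by
      fun_prop
    have key := intervalIntegral.norm_integral_le_abs_of_norm_le (μ := MeasureTheory.volume)
      (MeasureTheory.ae_restrict_of_forall_mem measurableSet_uIoc hb) (hcont.intervalIntegrable s t)
    refine key.trans (le_of_eq ?_)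
    have e : (fun r : ℝ => C * ((C * |r - s|) ^ n / n.factorial * ‖(1 : 𝔸)‖)) =
        fun r => (C ^ (n + 1) / n.factorial * ‖(1 : 𝔸)‖) * |r - s| ^ n := by
      funext r; rw [mul_pow]; ring
    have hint : |∫ r in s..t, |r - s| ^ n| = |t - s| ^ (n + 1) / (n + 1) := by
      have := integral_pow_abs_sub_uIoc (a := s) (b := t) n
      rw [intervalIntegral.abs_intervalIntegral_eq, this, abs_of_nonneg (by positivity)]
    rw [e, intervalIntegral.integral_const_mul, abs_mul, hint, abs_of_nonneg (by positivity),
      Nat.factorial_succ, mul_pow]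
    push_cast
    have : (n.factorial : ℝ) ≠ 0 := by positivity
    have : (n : ℝ) + 1 ≠ 0 := by positivity
    field_simp

/-- For a continuous Hamiltonian the Dyson series converges. -/
theorem summable_dysonTerm [CompleteSpace 𝔸] {H : ℝ → 𝔸} (hH : Continuous H)
    (s t : ℝ) :
    Summable fun n => dysonTerm H s n t := by
  obtain ⟨C, hC⟩ :=
    (isCompact_Icc (a := min s t - 1) (b := max s t + 1)).exists_bound_of_continuousOn
    hH.continuousOn
  have hs : s ∈ Set.Ioo (min s t - 1) (max s t + 1) :=
    ⟨by linarith [min_le_left s t], by linarith [le_max_left s t]⟩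
  have ht : t ∈ Set.Ioo (min s t - 1) (max s t + 1) :=
    ⟨by linarith [min_le_right s t], by linarith [le_max_right s t]⟩
  exact .of_norm_bounded ((Real.summable_pow_div_factorial (C * |t - s|)).mul_right ‖(1 : 𝔸)‖)
    fun n => norm_dysonTerm_le hs (fun r hr => hC r (Set.Ioo_subset_Icc_self hr)) n t ht

theorem evolution_self (H : ℝ → 𝔸) (s : ℝ) : evolution H s s = 1 := by
  rw [evolution, tsum_eq_single 0]
  · rfl
  · intro n hn
    obtain ⟨n, rfl⟩ := Nat.exists_eq_succ_of_ne_zero hn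
    simp [dysonTerm]

/-- The time-ordered exponential solves the Schrödinger equation `∂_t U = -i H(t) U`. -/
theorem hasDerivAt_evolution [CompleteSpace 𝔸] {H : ℝ → 𝔸} (hH : Continuous H) (s t : ℝ) :
    HasDerivAt (fun t => evolution H t s) ((-I) • (H t * evolution H t s)) t := by
  set a := min s t - 1
  set b := max s t + 1
  have hs : s ∈ Set.Ioo a b :=
    ⟨by linarith [min_le_left s t], by linarith [le_max_left s t]⟩
  have ht : t ∈ Set.Ioo a b :=
    ⟨by linarith [min_le_right s t], by linarith [le_max_right s t]⟩
  obtain ⟨C, hC⟩ := (isCompact_Icc (a := a) (b := b)).exists_bound_of_continuousOn hH.continuousOn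
  have hC' : ∀ r ∈ Set.Ioo a b, ‖H r‖ ≤ C := fun r hr => hC r (Set.Ioo_subset_Icc_self hr)
  have hC0 : 0 ≤ C := (norm_nonneg _).trans (hC' s hs)
  have hb : ∀ n, ∀ y ∈ Set.Ioo a b, ‖(-I) • (H y * dysonTerm H s n y)‖ ≤
      C * ((C * (b - a)) ^ n / n.factorial * ‖(1 : 𝔸)‖) := by
    intro n y hy
    rw [norm_smul]
    simp only [norm_neg, Complex.norm_I, one_mul]
    refine (norm_mul_le _ _).trans
      (mul_le_mul (hC' y hy) ((norm_dysonTerm_le hs hC' n y hy).trans ?_) (norm_nonneg _) hC0)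
    have : |y - s| ≤ b - a := abs_le.2 ⟨by linarith [hy.1, hs.2], by linarith [hy.2, hs.1]⟩
    gcongr
  have h1 := hasDerivAt_tsum_of_isPreconnected (t := Set.Ioo a b)
    (g := fun n => dysonTerm H s (n + 1)) (g' := fun n y => (-I) • (H y * dysonTerm H s n y))
    (((Real.summable_pow_div_factorial (C * (b - a))).mul_right ‖(1 : 𝔸)‖).mul_left C)
    isOpen_Ioo isPreconnected_Ioo (fun n y _ => hasDerivAt_dysonTerm_succ hH s n y) hb ht
    ((summable_nat_add_iff 1).2 (summable_dysonTerm hH s t)) ht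
  have h2 : (fun t => evolution H t s) = fun t => 1 + ∑' n, dysonTerm H s (n + 1) t := by
    funext y
    rw [evolution, (summable_dysonTerm hH s y).tsum_eq_zero_add]
    rfl
  have h3 : (-I) • (H t * evolution H t s) = ∑' n, (-I) • (H t * dysonTerm H s n t) := by
    have hsum := summable_dysonTerm hH s t
    rw [evolution, ← hsum.tsum_mul_left, Summable.tsum_const_smul]
    exact hsum.mul_left _
  rw [h2, h3]
  exact h1.const_add 1

end Algebra

/-- The coefficients `α j` and the numbers of steps `k j` give a time-independent multi-product
formula of order `2 m`: for any finite number of self-adjoint operators on any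
finite-dimensional Hilbert space,
`e^{-i H x} = ∑ j, α j • U₂(x / k j)^(k j) + O(x^(2 m + 1))` as `x ↓ 0`, where `H` is
their sum and `U₂` is the Strang formula. -/
def IsTimeIndependentMPF {M : ℕ} (α : Fin M → ℝ) (k : Fin M → ℕ) (m : ℕ) : Prop :=
  ∀ (d Λ : ℕ) (A : Fin Λ → (EuclideanSpace ℂ (Fin d) →L[ℂ] EuclideanSpace ℂ (Fin d))),
    (∀ l, IsSelfAdjoint (A l)) →
      (fun x : ℝ => NormedSpace.exp ((-I * (x : ℂ)) • ∑ l, A l) -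
        ∑ j, (α j : ℂ) • strang A (x / k j) ^ k j) =O[𝓝[>] 0] fun x : ℝ => x ^ (2 * m + 1)

end MPF

end

/-! Time is made a further generator. On smooth operator-valued functions, `f ↦ f(· + x) U(· + x,
·)` is a one-parameter family with generator `D + ∑ R_l`, where `D = d/dt` and `R_l` is right
multiplication by `-i H_l`. A Strang step for `D, R_1, …, R_Λ` with `D` outermost consists of a half
shift, the exponentials and a half shift, so it evaluates the Hamiltonians at the midpoint: it is
`U₂` (`palindrome_stepFactor_apply`). The theorem is thus the time-independent formula with `Λ + 1`
generators, applied to the constant function `1`.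

The hypothesis speaks only of self-adjoint matrices, and `D` is not one, so the transfer is formal.
The degree `n` coefficient of the error is a universal homogeneous noncommutative polynomial of
degree `n` in the generators. For `n ≤ 2m` it vanishes at all Hermitian matrices; adjacency matrices
of labelled paths separate words of length `n` (`pathMatrix_reverse_prod_apply`), so it is zero in
the free algebra and hence in every algebra (`IsTimeIndependentMPF.coeff_defectSeries`). Conversely,
true operator families expand as their formal exponentials, locally uniformly in `t`
(`OpAsymp.of_hasDerivAt`, `OpAsymp.mul`), so vanishing coefficients yield the error bound. -/

noncomputable section

namespace MPF

/-! ### Formal exponentials, and separation of words by Hermitian matrices. -/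

section Formal

/-- The product of a finite family, taken once in increasing and then in decreasing order. -/
def palindrome {R : Type*} [Monoid R] {Λ : ℕ} (e : Fin Λ → R) : R :=
  (List.ofFn e).prod * (List.ofFn e).reverse.prod

theorem map_palindrome {R S : Type*} [Monoid R] [Monoid S] (f : R →* S) {Λ : ℕ} (e : Fin Λ → R) :
    f (palindrome e) = palindrome fun l => f (e l) := by
  simp [palindrome, map_list_prod, List.map_ofFn, Function.comp_def]

theorem palindrome_cons {R : Type*} [Monoid R] {Λ : ℕ} (s : R) (e : Fin Λ → R) :
    palindrome (Fin.cons s e : Fin (Λ + 1) → R) = s * palindrome e * s := by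
  simp [palindrome, List.ofFn_succ, mul_assoc]

variable {B : Type*} [Ring B] [Algebra ℝ B]

/-- The formal exponential `∑ n, aⁿ xⁿ / n!`. -/
def expSeries (a : B) : PowerSeries B :=
  PowerSeries.mk fun n => ((n.factorial : ℝ)⁻¹) • a ^ n

/-- The formal power series of the error of a multi-product formula. -/
def defectSeries {M Λ : ℕ} (α : Fin M → ℝ) (k : Fin M → ℕ) (a : Fin Λ → B) : PowerSeries B :=
  expSeries (∑ l, a l) -
    -- The palindrome meets each exponential twice, hence half of the substep `1 / k j`.
    ∑ j, α j • (palindrome fun l => expSeries (((k j : ℝ)⁻¹ / 2) • a l)) ^ k j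

variable {B' : Type*} [Ring B'] [Algebra ℝ B']

theorem map_expSeries (f : B →ₐ[ℝ] B') (a : B) :
    PowerSeries.map (f : B →+* B') (expSeries a) = expSeries (f a) := by
  ext n
  simp [expSeries]

theorem map_real_smul (f : B →ₐ[ℝ] B') (c : ℝ) (φ : PowerSeries B) :
    PowerSeries.map (f : B →+* B') (c • φ) = c • PowerSeries.map (f : B →+* B') φ := by
  ext n
  simp

theorem map_defectSeries (f : B →ₐ[ℝ] B') {M Λ : ℕ} (α : Fin M → ℝ) (k : Fin M → ℕ)
    (a : Fin Λ → B) :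
    PowerSeries.map (f : B →+* B') (defectSeries α k a) = defectSeries α k fun l => f (a l) := by
  have h := fun e : Fin Λ → PowerSeries B =>
    map_palindrome (PowerSeries.map (f : B →+* B') : PowerSeries B →* PowerSeries B') e
  simp only [MonoidHom.coe_coe] at h
  simp only [defectSeries, map_sub, map_sum, map_real_smul, map_pow, h, map_expSeries, map_smul]

/-- Power series whose `n`-th coefficient is homogeneous of degree `n` for the grading generated
by `W`. -/
def gradedSeries (W : Submodule ℝ B) : Submonoid (PowerSeries B) where
  carrier := {φ | ∀ n, PowerSeries.coeff n φ ∈ W ^ n}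
  mul_mem' {φ ψ} hφ hψ n := by
    rw [PowerSeries.coeff_mul]
    refine Submodule.sum_mem _ fun p hp => ?_
    rw [← Finset.HasAntidiagonal.mem_antidiagonal.1 hp, pow_add]
    exact Submodule.mul_mem_mul (hφ _) (hψ _)
  one_mem' n := by
    rw [PowerSeries.coeff_one]
    split_ifs with h
    · subst h
      rw [pow_zero]
      exact Submodule.one_le.1 le_rfl
    · exact zero_mem _

theorem expSeries_mem_gradedSeries {W : Submodule ℝ B} {a : B} (ha : a ∈ W) :
    expSeries a ∈ gradedSeries W := fun n => by
  rw [expSeries, PowerSeries.coeff_mk]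
  exact Submodule.smul_mem _ _ (Submodule.pow_mem_pow _ ha n)

theorem coeff_defectSeries_mem {W : Submodule ℝ B} {M Λ : ℕ} (α : Fin M → ℝ) (k : Fin M → ℕ)
    {a : Fin Λ → B} (ha : ∀ l, a l ∈ W) (n : ℕ) :
    PowerSeries.coeff n (defectSeries α k a) ∈ W ^ n := by
  rw [defectSeries, map_sub, map_sum]
  refine Submodule.sub_mem _ (expSeries_mem_gradedSeries (Submodule.sum_mem _ fun l _ => ha l) n)
    (Submodule.sum_mem _ fun j _ => ?_)
  rw [PowerSeries.coeff_smul]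
  refine Submodule.smul_mem _ _ ?_
  have h : ∀ l, expSeries (((k j : ℝ)⁻¹ / 2) • a l) ∈ gradedSeries W := fun l =>
    expSeries_mem_gradedSeries (Submodule.smul_mem _ _ (ha l))
  have h' : palindrome (fun l => expSeries (((k j : ℝ)⁻¹ / 2) • a l)) ∈ gradedSeries W := by
    refine mul_mem (list_prod_mem ?_) (list_prod_mem ?_) <;> simpa [List.mem_ofFn] using h
  exact pow_mem h' (k j) n

open scoped Pointwise in
/-- A homogeneous element of a free algebra vanishes if functionals dual to the words vanish
on it. -/
theorem freeAlgebra_eq_zero {X : Type*} [Finite X] {n : ℕ} {P : FreeAlgebra ℝ X}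
    (hP : P ∈ Submodule.span ℝ (Set.range (FreeAlgebra.ι ℝ : X → FreeAlgebra ℝ X)) ^ n)
    (F : (Fin n → X) → FreeAlgebra ℝ X →ₗ[ℝ] ℂ) {z : ℂ} (hz : z ≠ 0)
    (hF : ∀ w v, F w ((List.ofFn fun i => FreeAlgebra.ι ℝ (v i)).prod) =
      open Classical in if v = w then z else 0)
    (h0 : ∀ w, F w P = 0) : P = 0 := by
  classical
  have := Fintype.ofFinite X
  have hset : (Set.range (FreeAlgebra.ι ℝ : X → FreeAlgebra ℝ X)) ^ n =
      Set.range fun v : Fin n → X => (List.ofFn fun i => FreeAlgebra.ι ℝ (v i)).prod := by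
    ext y
    rw [Set.mem_pow, Set.mem_range]
    constructor
    · rintro ⟨f, rfl⟩
      choose g hg using fun i => (f i).2
      exact ⟨g, by simp [hg]⟩
    · rintro ⟨v, rfl⟩
      exact ⟨fun i => ⟨_, v i, rfl⟩, rfl⟩
  rw [Submodule.span_pow, hset, Submodule.mem_span_range_iff_exists_fun] at hP
  obtain ⟨c, rfl⟩ := hP
  refine Finset.sum_eq_zero fun w _ => ?_
  have hw := h0 w
  simp only [map_sum, map_smul, hF] at hw
  simp only [smul_ite, smul_zero, Finset.sum_ite_eq', Finset.mem_univ, if_true, smul_eq_zero,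
    hz, or_false] at hw
  rw [hw, zero_smul]

/-- The adjacency matrix of the path `0, 1, …, n`, restricted to the edges labelled `x`, times
`z`; the edge from `i` to `i + 1` has the label `w[i]`. -/
def pathMatrix {X : Type*} (w : List X) (z : ℂ) (x : X) :
    Matrix (Fin (w.length + 1)) (Fin (w.length + 1)) ℂ :=
  open Classical in
  fun i j => if (i.1 + 1 = j.1 ∧ w[i.1]? = some x) ∨ (j.1 + 1 = i.1 ∧ w[j.1]? = some x)
    then z else 0

theorem pathMatrix_transpose {X : Type*} (w : List X) (z : ℂ) (x : X) :
    (pathMatrix w z x).transpose = pathMatrix w z x := by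
  ext i j
  simp only [Matrix.transpose_apply, pathMatrix]
  congr 1
  rw [or_comm]

theorem pathMatrix_isHermitian {X : Type*} (w : List X) (x : X) :
    (pathMatrix w 1 x).IsHermitian := by
  ext i j
  rw [Matrix.conjTranspose_apply, ← Matrix.transpose_apply (pathMatrix w 1 x),
    pathMatrix_transpose]
  simp only [pathMatrix]
  split_ifs <;> simp

/-- The entry counts walks from `i` to the last vertex with labels `u`. There are at most as many
steps as the distance, so every step must go forward, and the labels met are then the remaining
letters of `w`. -/
theorem pathMatrix_prod_apply {X : Type*} (w : List X) (z : ℂ) (u : List X)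
    (i : Fin (w.length + 1)) (hi : i.1 + u.length ≤ w.length) :
    (u.map (pathMatrix w z)).prod i (Fin.last _) =
      open Classical in if w.drop i.1 = u then z ^ u.length else 0 := by
  classical
  induction u generalizing i with
  | nil =>
    simp only [List.map_nil, List.prod_nil, Matrix.one_apply, List.drop_eq_nil_iff, pow_zero,
      List.length_nil, Fin.ext_iff, Fin.val_last]
    congr 1
    have := i.2
    simp only [eq_iff_iff]
    omega
  | cons x u ih =>
    simp only [List.length_cons] at hi
    have hi' : i.1 < w.length := by omega
    rw [List.map_cons, List.prod_cons, Matrix.mul_apply,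
      Finset.sum_eq_single (⟨i.1 + 1, by omega⟩ : Fin (w.length + 1))]
    · rw [ih _ (by simp only; omega), List.drop_eq_getElem_cons hi']
      have h1 : pathMatrix w z x i ⟨i.1 + 1, by omega⟩ = if w[i.1] = x then z else 0 := by
        have : ¬ (i.1 + 1 + 1 = i.1) := by omega
        simp [pathMatrix, hi', this]
      rw [h1]
      simp only [List.cons.injEq, List.length_cons]
      split_ifs <;> simp_all [pow_succ']
    · intro j _ hj
      by_cases hji : j.1 + 1 = i.1
      · rw [ih j (by omega), if_neg, mul_zero]
        intro h
        have := congrArg List.length h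
        rw [List.length_drop] at this
        omega
      · have : ¬ (i.1 + 1 = j.1) := fun h => hj (Fin.ext h.symm)
        simp [pathMatrix, hji, this]
    · simp

/-- Transposition reverses the product and swaps the indices, while the factors are symmetric. The
reversed form is the one needed because words in right multiplications act in reverse order. -/
theorem pathMatrix_reverse_prod_apply {X : Type*} (w u : List X) (z : ℂ)
    (h : u.length = w.length) :
    (u.map (pathMatrix w z)).reverse.prod (Fin.last _) 0 =
      open Classical in if u = w then z ^ w.length else 0 := by
  have h1 := pathMatrix_prod_apply w z u 0 (by simp [h])
  rw [← Matrix.transpose_apply (List.prod _), Matrix.transpose_list_prod, List.map_map] at h1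
  have h2 : Matrix.transpose ∘ pathMatrix w z = pathMatrix w z := by
    funext x
    exact pathMatrix_transpose w z x
  rw [h2] at h1
  rw [h1, h]
  by_cases huw : u = w
  · simp [huw]
  · simp [huw, Ne.symm huw]

end Formal

/-! ### Locally uniform asymptotic expansions of operator families. -/

section Asymptotics

set_option linter.unusedSectionVars false

variable {𝔸 : Type*} [NormedRing 𝔸] [NormedAlgebra ℝ 𝔸]

/-- `r x t = O(x ^ N)` as `x ↓ 0`, locally uniformly in `t`. -/
def LocO (r : ℝ → ℝ → 𝔸) (N : ℕ) : Prop :=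
  ∀ K : Set ℝ, IsCompact K →
    (fun p : ℝ × ℝ => r p.2 p.1) =O[𝓟 K ×ˢ 𝓝[≥] 0] fun p : ℝ × ℝ => p.2 ^ N

theorem LocO.add {r s : ℝ → ℝ → 𝔸} {N : ℕ} (hr : LocO r N) (hs : LocO s N) :
    LocO (fun x => r x + s x) N := fun K hK => (hr K hK).add (hs K hK)

theorem LocO.sub {r s : ℝ → ℝ → 𝔸} {N : ℕ} (hr : LocO r N) (hs : LocO s N) :
    LocO (fun x => r x - s x) N := fun K hK => (hr K hK).sub (hs K hK)

theorem LocO.const_smul {r : ℝ → ℝ → 𝔸} {N : ℕ} (hr : LocO r N) (c : ℝ) :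
    LocO (fun x => c • r x) N := fun K hK => (hr K hK).const_smul_left c

theorem LocO.zero (N : ℕ) : LocO (fun _ => (0 : ℝ → 𝔸)) N :=
  fun _ _ => Asymptotics.isBigO_zero _ _

theorem LocO.sum {ι : Type*} {s : Finset ι} {r : ι → ℝ → ℝ → 𝔸} {N : ℕ}
    (h : ∀ i ∈ s, LocO (r i) N) : LocO (fun x => ∑ i ∈ s, r i x) N := by
  intro K hK
  simp only [Finset.sum_apply]
  exact Asymptotics.IsBigO.fun_sum fun i hi => h i hi K hK

theorem LocO.pow_smul {r : ℝ → ℝ → 𝔸} {N : ℕ} (hr : LocO r N) (i : ℕ) :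
    LocO (fun x => x ^ i • r x) (i + N) := by
  intro K hK
  have := (Asymptotics.isBigO_refl (fun p : ℝ × ℝ => p.2 ^ i) (𝓟 K ×ˢ 𝓝[≥] 0)).smul (hr K hK)
  simpa only [pow_add, smul_eq_mul, Pi.smul_apply] using this

open scoped Pointwise in
-- For `x ∈ [0, 1]` the shifted times stay in the compact set `K + c[0, 1]`; this is why the bounds
-- are required on all compact sets.
theorem LocO.comp_add {r : ℝ → ℝ → 𝔸} {N : ℕ} (hr : LocO r N) (c : ℝ) :
    LocO (fun x t => r x (t + c * x)) N := by
  intro K hK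
  have hK' : IsCompact (K + (fun x => c * x) '' Set.Icc 0 1) :=
    hK.add (isCompact_Icc.image (by fun_prop))
  have ht : Tendsto (fun p : ℝ × ℝ => (p.1 + c * p.2, p.2)) (𝓟 K ×ˢ 𝓝[≥] 0)
      (𝓟 (K + (fun x => c * x) '' Set.Icc 0 1) ×ˢ 𝓝[≥] 0) := by
    refine Tendsto.prodMk ?_ tendsto_snd
    rw [tendsto_principal]
    have h1 : ∀ᶠ x : ℝ in 𝓝[≥] 0, x ∈ Set.Icc (0 : ℝ) 1 := Icc_mem_nhdsGE one_pos
    filter_upwards [(eventually_principal.2 fun x (hx : x ∈ K) => hx).prod_mk h1] with p hp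
    exact Set.add_mem_add hp.1 ⟨_, hp.2, rfl⟩
  exact (hr _ hK').comp_tendsto ht

theorem LocO.mul_right {r s : ℝ → ℝ → 𝔸} {N : ℕ} (hr : LocO r N) (hs : LocO s 0) :
    LocO (fun x => r x * s x) N := by
  intro K hK
  simpa using (hr K hK).mul (hs K hK)

theorem LocO.of_continuous {g : ℝ → ℝ → 𝔸} (hg : Continuous fun p : ℝ × ℝ => g p.2 p.1) :
    LocO g 0 := by
  intro K hK
  obtain ⟨C, hC⟩ := (hK.prod (isCompact_Icc (a := (0 : ℝ)) (b := 1))).exists_bound_of_continuousOn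
    hg.continuousOn
  refine Asymptotics.IsBigO.of_bound C ?_
  have h1 : ∀ᶠ x : ℝ in 𝓝[≥] 0, x ∈ Set.Icc (0 : ℝ) 1 := Icc_mem_nhdsGE one_pos
  filter_upwards [(eventually_principal.2 fun x (hx : x ∈ K) => hx).prod_mk h1] with p hp
  simpa using hC p hp

variable (𝔸) in
/-- The smooth `𝔸`-valued functions on the line. -/
def smoothFun : Submodule ℝ (ℝ → 𝔸) where
  carrier := {f | ContDiff ℝ ∞ f}
  add_mem' {f g} (hf : ContDiff ℝ ∞ f) (hg : ContDiff ℝ ∞ g) := hf.add hg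
  zero_mem' := (contDiff_const : ContDiff ℝ ∞ fun _ : ℝ => (0 : 𝔸))
  smul_mem' c f (hf : ContDiff ℝ ∞ f) := hf.const_smul c

theorem contDiff_smoothFun (f : smoothFun 𝔸) : ContDiff ℝ ∞ f.1 := f.2

/-- The derivation `d/dt` on smooth functions. -/
def derivEnd : Module.End ℝ (smoothFun 𝔸) where
  toFun f := ⟨deriv f.1, (contDiff_infty_iff_deriv.1 (contDiff_smoothFun f)).2⟩
  map_add' f g := Subtype.ext <| funext fun t => deriv_add
    ((contDiff_infty_iff_deriv.1 (contDiff_smoothFun f)).1 t) ((contDiff_infty_iff_deriv.1 (contDiff_smoothFun g)).1 t)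
  map_smul' c f := Subtype.ext <| funext fun t => deriv_const_smul c
    ((contDiff_infty_iff_deriv.1 (contDiff_smoothFun f)).1 t)

/-- Multiplication by a smooth function from the right. -/
def mulRightEnd (L : smoothFun 𝔸) : Module.End ℝ (smoothFun 𝔸) where
  toFun f := ⟨f.1 * L.1, (contDiff_smoothFun f).mul (contDiff_smoothFun L)⟩
  map_add' f g := Subtype.ext (add_mul f.1 g.1 L.1)
  map_smul' c f := Subtype.ext (smul_mul_assoc c f.1 L.1)

theorem hasDerivAt_smoothFun (f : smoothFun 𝔸) (t : ℝ) :
    HasDerivAt f.1 ((derivEnd f).1 t) t :=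
  ((contDiff_infty_iff_deriv.1 (contDiff_smoothFun f)).1 t).hasDerivAt

theorem continuous_smoothFun (f : smoothFun 𝔸) : Continuous f.1 :=
  (contDiff_smoothFun f).continuous

/-- The family of operators `G x` is asymptotic, as `x ↓ 0`, to the formal power series `Ψ` of
operators on smooth functions. -/
structure OpAsymp (G : ℝ → Module.End ℝ (ℝ → 𝔸)) (Ψ : PowerSeries (Module.End ℝ (smoothFun 𝔸))) :
    Prop where
  locO : ∀ (r : ℝ → ℝ → 𝔸) (N : ℕ), LocO r N → LocO (fun x => G x (r x)) N
  expand : ∀ (f : smoothFun 𝔸) (N : ℕ), LocO (fun x => G x f.1 -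
    ∑ n ∈ Finset.range N, x ^ n • (PowerSeries.coeff n Ψ f).1) N

theorem OpAsymp.one : OpAsymp (fun _ => 1) (1 : PowerSeries (Module.End ℝ (smoothFun 𝔸))) where
  locO r N hr := hr
  expand f N := by
    cases N with
    | zero => simpa using LocO.of_continuous (g := fun _ => f.1) ((continuous_smoothFun f).comp continuous_fst)
    | succ N =>
      simp only [Finset.sum_range_succ', PowerSeries.coeff_one]
      simpa using LocO.zero (N + 1)

/-- `G₁` preserves the remainder of `G₂ f`; the term `x ^ j` of the expansion of `G₂ f` then needs
`G₁` only to order `N - j`. Collecting powers of `x` gives the Cauchy product. -/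
theorem OpAsymp.mul {G₁ G₂ : ℝ → Module.End ℝ (ℝ → 𝔸)}
    {Ψ₁ Ψ₂ : PowerSeries (Module.End ℝ (smoothFun 𝔸))} (h₁ : OpAsymp G₁ Ψ₁) (h₂ : OpAsymp G₂ Ψ₂) :
    OpAsymp (fun x => G₁ x * G₂ x) (Ψ₁ * Ψ₂) where
  locO r N hr := h₁.locO _ N (h₂.locO r N hr)
  expand f N := by
    have hr := h₁.locO _ N (h₂.expand f N)
    have hs : LocO (fun x => ∑ j ∈ Finset.range N, x ^ j • (G₁ x (PowerSeries.coeff j Ψ₂ f).1 -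
        ∑ i ∈ Finset.range (N - j),
          x ^ i • (PowerSeries.coeff i Ψ₁ (PowerSeries.coeff j Ψ₂ f)).1)) N := by
      refine LocO.sum fun j hj => ?_
      have := (h₁.expand (PowerSeries.coeff j Ψ₂ f) (N - j)).pow_smul j
      rwa [Nat.add_sub_cancel' (Finset.mem_range.1 hj).le] at this
    convert hr.add hs using 2 with x
    have e : ∑ n ∈ Finset.range N, x ^ n • (PowerSeries.coeff n (Ψ₁ * Ψ₂) f).1 =
        ∑ j ∈ Finset.range N, ∑ i ∈ Finset.range (N - j),
          x ^ j • x ^ i • (PowerSeries.coeff i Ψ₁ (PowerSeries.coeff j Ψ₂ f)).1 := by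
      rw [← Finset.sum_range_diag_flip N fun j i =>
        x ^ j • x ^ i • (PowerSeries.coeff i Ψ₁ (PowerSeries.coeff j Ψ₂ f)).1]
      refine Finset.sum_congr rfl fun n _ => ?_
      rw [PowerSeries.coeff_mul, ← Finset.Nat.sum_antidiagonal_eq_sum_range_succ fun j i =>
        x ^ j • x ^ i • (PowerSeries.coeff i Ψ₁ (PowerSeries.coeff j Ψ₂ f)).1,
        ← Finset.Nat.sum_antidiagonal_swap]
      simp only [LinearMap.sum_apply, Submodule.coe_sum, Finset.smul_sum]
      refine Finset.sum_congr rfl fun p hp => ?_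
      rw [← Finset.HasAntidiagonal.mem_antidiagonal.1 hp, smul_smul, ← pow_add, add_comm]
      rfl
    rw [e]
    simp only [Module.End.mul_apply, map_sub, map_sum, map_smul, smul_sub, Finset.smul_sum,
      Finset.sum_sub_distrib]
    abel

theorem OpAsymp.list_prod {ι : Type*} (l : List ι) {G : ι → ℝ → Module.End ℝ (ℝ → 𝔸)}
    {Ψ : ι → PowerSeries (Module.End ℝ (smoothFun 𝔸))} (h : ∀ i, OpAsymp (G i) (Ψ i)) :
    OpAsymp (fun x => (l.map fun i => G i x).prod) (l.map Ψ).prod := by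
  induction l with
  | nil => simpa using OpAsymp.one
  | cons i l ih => simpa using (h i).mul ih

theorem OpAsymp.palindrome {Λ : ℕ} {G : Fin Λ → ℝ → Module.End ℝ (ℝ → 𝔸)}
    {Ψ : Fin Λ → PowerSeries (Module.End ℝ (smoothFun 𝔸))} (h : ∀ i, OpAsymp (G i) (Ψ i)) :
    OpAsymp (fun x => MPF.palindrome fun i => G i x) (MPF.palindrome Ψ) := by
  simp only [MPF.palindrome, List.ofFn_eq_map, ← List.map_reverse]
  exact (OpAsymp.list_prod _ h).mul (OpAsymp.list_prod _ h)

theorem OpAsymp.pow {G : ℝ → Module.End ℝ (ℝ → 𝔸)}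
    {Ψ : PowerSeries (Module.End ℝ (smoothFun 𝔸))} (h : OpAsymp G Ψ) (n : ℕ) :
    OpAsymp (fun x => G x ^ n) (Ψ ^ n) := by
  induction n with
  | zero => simpa using OpAsymp.one
  | succ n ih => simpa only [pow_succ] using ih.mul h

/-- A one-parameter family with `d/dx (G x f) = G x (a f)` and `G 0 f = f` for smooth `f` is
asymptotic to the formal exponential of its generator `a`. -/
theorem OpAsymp.of_hasDerivAt {G : ℝ → Module.End ℝ (ℝ → 𝔸)} {a : Module.End ℝ (smoothFun 𝔸)}
    (hO : ∀ (r : ℝ → ℝ → 𝔸) (N : ℕ), LocO r N → LocO (fun x => G x (r x)) N)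
    (h0 : ∀ f : smoothFun 𝔸, G 0 f.1 = f.1)
    (hd : ∀ (f : smoothFun 𝔸) (t x : ℝ),
      HasDerivAt (fun x => G x f.1 t) (G x (a f).1 t) x) :
    OpAsymp G (expSeries a) where
  locO := hO
  expand f N := by
    simp only [expSeries, PowerSeries.coeff_mk, LinearMap.smul_apply, Submodule.coe_smul]
    induction N generalizing f with
    | zero => simpa using hO (fun _ => f.1) 0 (LocO.of_continuous
        ((continuous_smoothFun f).comp continuous_fst))
    | succ N ih =>
      intro K hK
      obtain ⟨C, hC0, hC⟩ := (ih (a f) K hK).exists_nonneg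
      replace hC := hC.bound
      -- The bound is needed on the whole segment from `0` to `x`, with one `ε` for all `t ∈ K`, in
      -- order to integrate it.
      obtain ⟨ε, hε, hb⟩ := ((hasBasis_principal K).prod (nhdsGE_basis (0 : ℝ))).eventually_iff.1 hC
      refine Asymptotics.IsBigO.of_bound C ?_
      refine ((hasBasis_principal K).prod (nhdsGE_basis (0 : ℝ))).eventually_iff.2 ⟨ε, hε, ?_⟩
      rintro ⟨t, x⟩ ⟨ht, hx⟩
      simp only at ht hx hb ⊢
      set u : ℝ → 𝔸 := fun y => (G y f.1 - ∑ n ∈ Finset.range (N + 1),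
        y ^ n • (n.factorial : ℝ)⁻¹ • ((a ^ n) f).1) t with hu
      have hu' : ∀ y, u y = G y f.1 t - (∑ n ∈ Finset.range N,
          y ^ (n + 1) • ((n + 1).factorial : ℝ)⁻¹ • ((a ^ (n + 1)) f).1 t + f.1 t) := by
        intro y
        simp [hu, Finset.sum_range_succ']
      have hu0 : u 0 = 0 := by
        rw [hu', h0]
        simp
      -- The derivative of the remainder of order `N + 1` for `f` is the remainder of order `N` for
      -- `a f`, which the induction hypothesis bounds.
      have hdu : ∀ y, HasDerivAt u ((G y (a f).1 - ∑ n ∈ Finset.range N,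
          y ^ n • (n.factorial : ℝ)⁻¹ • ((a ^ n) (a f)).1) t) y := by
        intro y
        rw [funext hu']
        simp only [Pi.sub_apply, Finset.sum_apply, Pi.smul_apply]
        refine (hd f t y).sub (HasDerivAt.add_const _ (HasDerivAt.fun_sum fun n _ => ?_))
        have := ((hasDerivAt_pow (n + 1) y).smul_const
          (((n + 1).factorial : ℝ)⁻¹ • ((a ^ (n + 1)) f).1 t))
        convert this using 1
        rw [pow_succ a n, Module.End.mul_apply, smul_smul, smul_smul, Nat.factorial_succ]
        congr 1
        have : (n.factorial : ℝ) ≠ 0 := by positivity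
        have : (n : ℝ) + 1 ≠ 0 := by positivity
        push_cast
        field_simp
      have hmv := norm_image_sub_le_of_norm_deriv_le_segment' (C := C * x ^ N)
        (fun y _ => (hdu y).hasDerivWithinAt) (fun y hy => ?_) x (Set.right_mem_Icc.2 hx.1)
      · rw [hu0, sub_zero, sub_zero] at hmv
        rw [Real.norm_of_nonneg (pow_nonneg hx.1 _), pow_succ, ← mul_assoc]
        exact hmv
      · have hb' := hb (x := (t, y)) ⟨ht, hy.1, hy.2.trans hx.2⟩
        simp only at hb'
        refine hb'.trans ?_
        rw [Real.norm_of_nonneg (pow_nonneg hy.1 _)]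
        exact mul_le_mul_of_nonneg_left (pow_le_pow_left₀ hy.1 hy.2.le _) hC0

end Asymptotics

/-! ### Shifts and right multiplications; from formal to analytic errors. -/

section Operators

variable {𝔸 : Type*} [NormedRing 𝔸] [NormedAlgebra ℝ 𝔸]

variable (𝔸) in
/-- The translation `f ↦ f (· + c)`. -/
def shiftOp (c : ℝ) : Module.End ℝ (ℝ → 𝔸) :=
  LinearMap.funLeft ℝ 𝔸 fun t => t + c

theorem opAsymp_shiftOp (c : ℝ) :
    OpAsymp (fun x => shiftOp 𝔸 (c * x)) (expSeries (c • derivEnd)) := by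
  refine .of_hasDerivAt (fun r N hr => hr.comp_add c) (fun f => ?_) fun f t x => ?_
  · funext t
    simp [shiftOp, LinearMap.funLeft_apply]
  · have h := (hasDerivAt_smoothFun f (t + c * x)).scomp x
      (((hasDerivAt_id x).const_mul c).const_add t)
    simpa [shiftOp, LinearMap.funLeft_apply, Function.comp_def] using h

theorem opAsymp_mulRight_exp [CompleteSpace 𝔸] (L : smoothFun 𝔸) :
    OpAsymp (fun x => LinearMap.mulRight ℝ fun t => NormedSpace.exp (x • L.1 t))
      (expSeries (mulRightEnd L)) := by
  have hL := continuous_smoothFun L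
  refine .of_hasDerivAt (fun r N hr => hr.mul_right (s := fun x t => NormedSpace.exp (x • L.1 t))
    (.of_continuous ?_)) (fun f => ?_) fun f t x => ?_
  · let _ := NormedAlgebra.restrictScalars ℚ ℝ 𝔸
    have := NormedSpace.exp_continuous (𝔸 := 𝔸)
    fun_prop
  · funext t
    simp
  · have h := (hasDerivAt_exp_smul_const' (𝕂 := ℝ) (L.1 t) x).const_mul (f.1 t)
    simpa [mulRightEnd, mul_assoc] using h

theorem mulRightEnd_smul (c : ℝ) (L : smoothFun 𝔸) : mulRightEnd (c • L) = c • mulRightEnd L :=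
  LinearMap.ext fun f => Subtype.ext (mul_smul_comm c f.1 L.1)

theorem mulRightEnd_sum {ι : Type*} (s : Finset ι) (L : ι → smoothFun 𝔸) :
    mulRightEnd (∑ i ∈ s, L i) = ∑ i ∈ s, mulRightEnd (L i) :=
  LinearMap.ext fun f => Subtype.ext <| by
    simp [mulRightEnd, Finset.mul_sum, LinearMap.sum_apply]

theorem opAsymp_mulRight_exp_smul [CompleteSpace 𝔸] (L : smoothFun 𝔸) (c : ℝ) :
    OpAsymp (fun x => LinearMap.mulRight ℝ fun t => NormedSpace.exp ((c * x) • L.1 t))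
      (expSeries (c • mulRightEnd L)) := by
  rw [← mulRightEnd_smul]
  convert opAsymp_mulRight_exp (c • L) using 5 with x t
  simp [smul_smul, mul_comm]

theorem list_prod_mulRight {R : Type*} [Ring R] [Algebra ℝ R] (l : List R) :
    (l.map (LinearMap.mulRight ℝ)).prod = LinearMap.mulRight ℝ l.reverse.prod := by
  induction l with
  | nil => simp [Module.End.one_eq_id]
  | cons b l ih => simp [ih, LinearMap.mulRight_mul, Module.End.mul_eq_comp]

/-- Right multiplication reverses products, but a palindrome is its own reversal. -/
theorem palindrome_mulRight {R : Type*} [Ring R] [Algebra ℝ R] {Λ : ℕ} (b : Fin Λ → R) :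
    (palindrome fun l => LinearMap.mulRight ℝ (b l)) = LinearMap.mulRight ℝ (palindrome b) := by
  have h1 : (List.ofFn fun l => LinearMap.mulRight ℝ (b l)) =
      (List.ofFn b).map (LinearMap.mulRight ℝ) := by simp [List.map_ofFn, Function.comp_def]
  rw [palindrome, h1, ← List.map_reverse, list_prod_mulRight, list_prod_mulRight,
    List.reverse_reverse, palindrome, LinearMap.mulRight_mul, Module.End.mul_eq_comp]

theorem list_prod_mulRightEnd {X : Type*} (L : X → smoothFun 𝔸) (u : List X) (f : smoothFun 𝔸)
    (t : ℝ) : ((u.map fun x => mulRightEnd (L x)).prod f).1 t =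
      f.1 t * (u.map fun x => (L x).1 t).reverse.prod := by
  induction u generalizing f with
  | nil => simp
  | cons x u ih =>
    rw [List.map_cons, List.prod_cons, Module.End.mul_apply]
    simp only [List.map_cons, List.reverse_cons, List.prod_append, List.prod_singleton,
      ← mul_assoc, ← ih]
    rfl

variable (𝔸) in
/-- The constant function `1`. -/
def oneFun : smoothFun 𝔸 :=
  ⟨1, (contDiff_const : ContDiff ℝ ∞ fun _ : ℝ => (1 : 𝔸))⟩

/-- A constant function. -/
def constFun (c : 𝔸) : smoothFun 𝔸 :=
  ⟨fun _ => c, (contDiff_const : ContDiff ℝ ∞ fun _ : ℝ => c)⟩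

/-- The error of a multi-product formula is asymptotic to the formal error. -/
theorem locO_defect {M Λ : ℕ} (α : Fin M → ℝ) (k : Fin M → ℕ)
    {a : Fin Λ → Module.End ℝ (smoothFun 𝔸)} {G : Fin Λ → ℝ → Module.End ℝ (ℝ → 𝔸)}
    {F : ℝ → Module.End ℝ (ℝ → 𝔸)} (hF : OpAsymp F (expSeries (∑ l, a l)))
    (hG : ∀ l (c : ℝ), OpAsymp (fun x => G l (c * x)) (expSeries (c • a l)))
    (f : smoothFun 𝔸) (N : ℕ) :
    LocO (fun x => F x f.1 - ∑ j, α j •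
        ((palindrome fun l => G l ((k j : ℝ)⁻¹ / 2 * x)) ^ k j) f.1 -
      ∑ n ∈ Finset.range N, x ^ n • (PowerSeries.coeff n (defectSeries α k a) f).1) N := by
  have h1 : LocO (fun x => ∑ j, α j • _) N := LocO.sum (s := Finset.univ) fun j _ =>
    (((OpAsymp.palindrome fun l => hG l ((k j : ℝ)⁻¹ / 2)).pow (k j)).expand f N).const_smul (α j)
  convert (hF.expand f N).sub h1 using 2 with x
  simp only [defectSeries, map_sub, map_sum, PowerSeries.coeff_smul, LinearMap.sub_apply,
    LinearMap.sum_apply, LinearMap.smul_apply, Submodule.coe_sub, Submodule.coe_sum,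
    Submodule.coe_smul, smul_sub, Finset.smul_sum, Finset.sum_sub_distrib]
  rw [Finset.sum_comm]
  simp only [smul_comm (α _)]
  abel

theorem locO_of_coeff_defectSeries_eq_zero {M Λ : ℕ} (α : Fin M → ℝ) (k : Fin M → ℕ)
    {a : Fin Λ → Module.End ℝ (smoothFun 𝔸)} {G : Fin Λ → ℝ → Module.End ℝ (ℝ → 𝔸)}
    {F : ℝ → Module.End ℝ (ℝ → 𝔸)} (hF : OpAsymp F (expSeries (∑ l, a l)))
    (hG : ∀ l (c : ℝ), OpAsymp (fun x => G l (c * x)) (expSeries (c • a l)))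
    (f : smoothFun 𝔸) {N : ℕ} (h0 : ∀ n < N, PowerSeries.coeff n (defectSeries α k a) = 0) :
    LocO (fun x => F x f.1 - ∑ j, α j •
        ((palindrome fun l => G l ((k j : ℝ)⁻¹ / 2 * x)) ^ k j) f.1) N := by
  have h := locO_defect α k hF hG f N
  have hs : ∀ x : ℝ, ∑ n ∈ Finset.range N,
      x ^ n • (PowerSeries.coeff n (defectSeries α k a) f).1 = 0 := fun x =>
    Finset.sum_eq_zero fun n hn => by
      rw [h0 n (Finset.mem_range.1 hn), LinearMap.zero_apply, Submodule.coe_zero, smul_zero]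
  simpa only [hs, sub_zero] using h

/-- Once the lower coefficients vanish, dividing by `x ^ n` and letting `x ↓ 0` isolates `v n`. -/
theorem coeff_eq_zero_of_isBigO {V : Type*} [NormedAddCommGroup V] [NormedSpace ℝ V] {N : ℕ}
    (v : ℕ → V)
    (h : (fun x : ℝ => ∑ n ∈ Finset.range N, x ^ n • v n) =O[𝓝[>] 0] fun x => x ^ N) :
    ∀ n < N, v n = 0 := by
  intro n
  induction n using Nat.strong_induction_on with
  | _ n ih =>
    intro hn
    have h1 : (fun x : ℝ => ∑ i ∈ Finset.range (N - n), x ^ i • v (n + i)) =O[𝓝[>] 0]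
        fun x => x ^ (N - n) := by
      have hpos : ∀ᶠ x : ℝ in 𝓝[>] 0, x ≠ 0 :=
        eventually_nhdsWithin_of_forall fun x (hx : 0 < x) => hx.ne'
      have h2 := (Asymptotics.isBigO_refl (fun x : ℝ => (x ^ n)⁻¹) (𝓝[>] 0)).smul h
      refine h2.congr' ?_ ?_
      · filter_upwards [hpos] with x hx
        have : ∑ i ∈ Finset.range N, x ^ i • v i =
            x ^ n • ∑ i ∈ Finset.range (N - n), x ^ i • v (n + i) := by
          conv_lhs => rw [← Nat.add_sub_cancel' hn.le]
          rw [Finset.sum_range_add, Finset.sum_eq_zero, zero_add, Finset.smul_sum]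
          · simp only [smul_smul, pow_add]
          · intro i hi
            have := Finset.mem_range.1 hi
            rw [ih i this (this.trans hn), smul_zero]
        simp only [this]
        rw [inv_smul_smul₀ (pow_ne_zero n hx)]
      · filter_upwards [hpos] with x hx
        rw [smul_eq_mul, pow_sub₀ x hx hn.le, mul_comm]
    have hne : N - n ≠ 0 := by omega
    have h3 : Tendsto (fun x : ℝ => x ^ (N - n)) (𝓝[>] 0) (𝓝 0) := by
      have : Continuous fun x : ℝ => x ^ (N - n) := by fun_prop
      simpa [hne] using (this.tendsto 0).mono_left nhdsWithin_le_nhds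
    have h4 := h1.trans_tendsto h3
    have h5 : Tendsto (fun x : ℝ => ∑ i ∈ Finset.range (N - n), x ^ i • v (n + i)) (𝓝[>] 0)
        (𝓝 (v n)) := by
      have : Continuous fun x : ℝ => ∑ i ∈ Finset.range (N - n), x ^ i • v (n + i) := by fun_prop
      convert (this.tendsto 0).mono_left nhdsWithin_le_nhds
      obtain ⟨q, hq⟩ := Nat.exists_eq_succ_of_ne_zero hne
      rw [hq, Finset.sum_range_succ']
      simp
    exact tendsto_nhds_unique h5 h4

end Operators

/-! ### The hypothesis forces the formal error to vanish. -/

section TimeIndependent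

theorem neg_I_mul_smul {𝔸 : Type*} [NormedRing 𝔸] [NormedAlgebra ℂ 𝔸] (x : ℝ) (A : 𝔸) :
    (-I * (x : ℂ)) • A = x • (-I) • A := by
  rw [mul_comm, mul_smul, Complex.coe_smul]

/-- Evaluation of noncommutative polynomials at `c`, with all the products in reverse order. -/
def revEval {𝔸 : Type*} [NormedRing 𝔸] [NormedAlgebra ℝ 𝔸] {X : Type*} (c : X → 𝔸) :
    FreeAlgebra ℝ X →ₗ[ℝ] 𝔸 where
  toFun P := (FreeAlgebra.lift ℝ (fun l => mulRightEnd (constFun (c l))) P (oneFun 𝔸)).1 0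
  map_add' P Q := by simp
  map_smul' r P := by simp

theorem revEval_word {𝔸 : Type*} [NormedRing 𝔸] [NormedAlgebra ℝ 𝔸] {X : Type*} (c : X → 𝔸)
    {n : ℕ} (v : Fin n → X) :
    revEval c (List.ofFn fun i => FreeAlgebra.ι ℝ (v i)).prod =
      ((List.ofFn v).map c).reverse.prod := by
  have h := list_prod_mulRightEnd (fun l => constFun (c l)) (List.ofFn v) (oneFun 𝔸) 0
  simp only [List.map_ofFn, Function.comp_def, constFun, oneFun, Pi.one_apply, one_mul] at h
  simp only [revEval, LinearMap.coe_mk, AddHom.coe_mk, map_list_prod, List.map_ofFn,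
    Function.comp_def, FreeAlgebra.lift_ι_apply, oneFun, constFun]
  exact h

/-- If a multi-product formula has order `2 m` for the operators `A`, then its formal error
vanishes at `-i A` up to order `2 m`. -/
theorem revEval_coeff_defectSeries {M : ℕ} {α : Fin M → ℝ} {k : Fin M → ℕ} {N : ℕ}
    {𝔸 : Type*} [NormedRing 𝔸] [NormedAlgebra ℂ 𝔸] [CompleteSpace 𝔸] {Λ : ℕ} (A : Fin Λ → 𝔸)
    (h : (fun x : ℝ => NormedSpace.exp ((-I * (x : ℂ)) • ∑ l, A l) -
        ∑ j, (α j : ℂ) • strang A (x / k j) ^ k j) =O[𝓝[>] 0] fun x : ℝ => x ^ N)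
    {n : ℕ} (hn : n < N) :
    revEval (fun l => -I • A l)
      (PowerSeries.coeff n (defectSeries α k (FreeAlgebra.ι ℝ : Fin Λ → _))) = 0 := by
  -- Constant functions put the time-independent formula into the same framework; it is read off at
  -- `t = 0` on the function `1`.
  set L : Fin Λ → smoothFun 𝔸 := fun l => constFun (-I • A l) with hL
  have hF := opAsymp_mulRight_exp (∑ l, L l)
  rw [mulRightEnd_sum] at hF
  have h1 := locO_defect α k
    (G := fun l y => LinearMap.mulRight ℝ fun t => NormedSpace.exp (y • (L l).1 t)) hF
    (fun l => opAsymp_mulRight_exp_smul (L l)) (oneFun _) N {0} isCompact_singleton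
  have ht : Tendsto (fun x : ℝ => ((0 : ℝ), x)) (𝓝[>] 0) (𝓟 {0} ×ˢ 𝓝[≥] 0) :=
    Tendsto.prodMk (tendsto_principal.2 (by simp))
      (tendsto_id.mono_right (nhdsWithin_mono _ Set.Ioi_subset_Ici_self))
  have h2 := h1.comp_tendsto ht
  have h3 := map_defectSeries (FreeAlgebra.lift ℝ fun l => mulRightEnd (L l)) α k
    (FreeAlgebra.ι ℝ : Fin Λ → _)
  simp only [FreeAlgebra.lift_ι_apply] at h3
  have h4 : ∀ n, revEval (fun l => -I • A l)
      (PowerSeries.coeff n (defectSeries α k (FreeAlgebra.ι ℝ : Fin Λ → _))) =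
      (PowerSeries.coeff n (defectSeries α k fun l => mulRightEnd (L l)) (oneFun _)).1 0 := by
    intro n
    rw [← h3, PowerSeries.coeff_map]
    rfl
  rw [h4]
  refine coeff_eq_zero_of_isBigO (fun n => (PowerSeries.coeff n
    (defectSeries α k fun l => mulRightEnd (L l)) (oneFun _)).1 0) ?_ n hn
  refine (h.sub h2).congr_left fun x => ?_
  have hs : ∀ j, (((palindrome fun l => LinearMap.mulRight ℝ fun t =>
      NormedSpace.exp (((k j : ℝ)⁻¹ / 2 * x) • (L l).1 t)) ^ k j) (oneFun _).1) 0 =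
      strang A (x / k j) ^ k j := by
    intro j
    rw [palindrome_mulRight, LinearMap.pow_mulRight, LinearMap.mulRight_apply]
    have he := map_palindrome (Pi.evalMonoidHom (fun _ : ℝ => 𝔸) 0)
      (fun l t => NormedSpace.exp (((k j : ℝ)⁻¹ / 2 * x) • (L l).1 t))
    simp only [Pi.evalMonoidHom_apply] at he
    simp only [oneFun, one_mul, Pi.pow_apply]
    rw [he]
    change _ = palindrome _ ^ _
    congr 2
    funext l
    rw [neg_I_mul_smul]
    simp only [hL, constFun]
    congr 2
    ring
  have he : (∑ l, L l).1 0 = -I • ∑ l, A l := by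
    simp [hL, constFun, Finset.smul_sum]
  simp only [Function.comp_apply, Pi.sub_apply, Finset.sum_apply, Pi.smul_apply, hs,
    Complex.coe_smul, neg_I_mul_smul, LinearMap.mulRight_apply, Pi.mul_apply, he]
  simp [oneFun]

/-- The formal error of a multi-product formula of order `2 m` vanishes up to order `2 m`
in every algebra. -/
theorem IsTimeIndependentMPF.coeff_defectSeries {M : ℕ} {α : Fin M → ℝ} {k : Fin M → ℕ} {m : ℕ}
    (h : IsTimeIndependentMPF α k m) {B : Type*} [Ring B] [Algebra ℝ B] {Λ : ℕ} (a : Fin Λ → B)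
    {n : ℕ} (hn : n ≤ 2 * m) : PowerSeries.coeff n (defectSeries α k a) = 0 := by
  have key : PowerSeries.coeff n (defectSeries α k (FreeAlgebra.ι ℝ : Fin Λ → _)) = 0 := by
    let T := fun w : Fin n → Fin Λ =>
      Matrix.toEuclideanCLM (𝕜 := ℂ) (n := Fin ((List.ofFn w).length + 1))
    -- The matrices with `z = 1` are Hermitian, as the hypothesis demands; the factor `-i` of the
    -- exponent moves into `z`, so the matching word has value `(-i) ^ n`.
    have hT : ∀ w l, -I • T w (pathMatrix (List.ofFn w) 1 l) =
        T w (pathMatrix (List.ofFn w) (-I) l) := by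
      intro w l
      rw [← map_smul]
      congr 1
      ext i j
      simp [pathMatrix]
    let F : (w : Fin n → Fin Λ) → FreeAlgebra ℝ (Fin Λ) →ₗ[ℝ] ℂ := fun w =>
      { toFun := fun P => (T w).symm
          (revEval (fun l => -I • T w (pathMatrix (List.ofFn w) 1 l)) P) (Fin.last _) 0
        map_add' := fun P Q => by simp
        map_smul' := fun c P => by
          rw [LinearMap.map_smul, ← Complex.coe_smul, map_smul]
          simp }
    refine freeAlgebra_eq_zero (n := n) (coeff_defectSeries_mem
      (W := Submodule.span ℝ (Set.range (FreeAlgebra.ι ℝ))) α k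
      (fun l => Submodule.subset_span (Set.mem_range_self l)) n) F (z := (-I) ^ n)
      (pow_ne_zero _ (neg_ne_zero.2 I_ne_zero)) (fun w v => ?_) fun w => ?_
    · have h2 := pathMatrix_reverse_prod_apply (List.ofFn w) (List.ofFn v) (-I) (by simp)
      simp only [F, LinearMap.coe_mk, AddHom.coe_mk, revEval_word, hT]
      rw [map_list_prod, List.map_reverse, List.map_map]
      simp only [Function.comp_def, StarAlgEquiv.symm_apply_apply]
      refine h2.trans ?_
      by_cases hvw : v = w <;> simp [List.ofFn_injective.eq_iff, hvw]
    · have h1 := revEval_coeff_defectSeries _ (h _ _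
        (fun l => T w (pathMatrix (List.ofFn w) 1 l)) fun l => by
          rw [IsSelfAdjoint, ← map_star]
          exact congrArg _ (pathMatrix_isHermitian _ l)) (by omega : n < 2 * m + 1)
      simp only [F, LinearMap.coe_mk, AddHom.coe_mk]
      rw [h1, map_zero, Matrix.zero_apply]
  -- By universality, vanishing in the free algebra passes to any `a`.
  have h2 := map_defectSeries (FreeAlgebra.lift ℝ a) α k (FreeAlgebra.ι ℝ)
  simp only [FreeAlgebra.lift_ι_apply] at h2
  rw [← h2, PowerSeries.coeff_map, key, map_zero]

end TimeIndependent

/-! ### Exact evolution and midpoint steps as operators on functions of time. -/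

section TimeDependent

variable {𝔸 : Type*} [NormedRing 𝔸] [NormedAlgebra ℂ 𝔸]

theorem norm_evolution_le [CompleteSpace 𝔸] {H : ℝ → 𝔸} (hH : Continuous H) {a b s t C : ℝ}
    (hs : s ∈ Set.Ioo a b) (ht : t ∈ Set.Ioo a b) (hC : ∀ r ∈ Set.Ioo a b, ‖H r‖ ≤ C) :
    ‖evolution H t s‖ ≤ Real.exp (C * |t - s|) * ‖(1 : 𝔸)‖ := by
  have h1 := (NormedSpace.expSeries_div_hasSum_exp (C * |t - s|)).mul_right ‖(1 : 𝔸)‖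
  rw [← Real.exp_eq_exp_ℝ] at h1
  exact (summable_dysonTerm hH s t).hasSum.norm_le_of_bounded h1
    fun n => norm_dysonTerm_le hs hC n t ht

theorem locO_evolution [CompleteSpace 𝔸] {H : ℝ → 𝔸} (hH : Continuous H) :
    LocO (fun x t => evolution H (t + x) t) 0 := by
  intro K hK
  obtain ⟨R, hR⟩ := hK.isBounded.subset_closedBall (0 : ℝ)
  obtain ⟨C, hC⟩ := (isCompact_Icc (a := -R - 1) (b := R + 2)).exists_bound_of_continuousOn
    hH.continuousOn
  refine Asymptotics.IsBigO.of_bound (Real.exp |C| * ‖(1 : 𝔸)‖) ?_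
  have h1 : ∀ᶠ x : ℝ in 𝓝[≥] 0, x ∈ Set.Icc (0 : ℝ) 1 := Icc_mem_nhdsGE one_pos
  filter_upwards [(eventually_principal.2 fun x (hx : x ∈ K) => hx).prod_mk h1] with p hp
  obtain ⟨⟨hp1, hp2⟩, hp3⟩ : (-R ≤ p.1 ∧ p.1 ≤ R) ∧ _ :=
    ⟨abs_le.1 (by simpa using hR hp.1), hp.2⟩
  have h2 := norm_evolution_le hH (a := -R - 1) (b := R + 2) (s := p.1) (t := p.1 + p.2)
    ⟨by linarith, by linarith⟩ ⟨by linarith [hp3.1], by linarith [hp3.2]⟩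
    fun r hr => hC r (Set.Ioo_subset_Icc_self hr)
  rw [pow_zero, norm_one (α := ℝ), mul_one]
  refine h2.trans ?_
  gcongr
  rw [add_sub_cancel_left, abs_of_nonneg hp3.1]
  exact (mul_le_mul_of_nonneg_right (le_abs_self C) hp3.1).trans
    (mul_le_of_le_one_right (abs_nonneg C) hp3.2)

/-- The operators `f ↦ f (· + x) U(· + x, ·)` are asymptotic to the formal exponential of the
sum of `d/dt` and the multiplication by `-i H`. -/
theorem opAsymp_evolution [CompleteSpace 𝔸] {H : ℝ → 𝔸} (hH : Continuous H) (L : smoothFun 𝔸)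
    (hL : ∀ t, L.1 t = -I • H t) :
    OpAsymp (fun x => LinearMap.mulRight ℝ (fun t => evolution H (t + x) t) * shiftOp 𝔸 x)
      (expSeries (derivEnd + mulRightEnd L)) := by
  refine .of_hasDerivAt (fun r N hr => ?_) (fun f => ?_) fun f t x => ?_
  · have h := (hr.comp_add 1).mul_right (locO_evolution hH)
    simp only [one_mul] at h
    exact h
  · funext t
    simp [shiftOp, LinearMap.funLeft_apply, evolution_self]
  -- With `U` on the right, `f'(t + x) U + f(t + x) (-i H(t + x)) U` is the family applied to `f' -
  -- i f H`; only the derivative of `U` in its later time enters.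
  · have h1 := (hasDerivAt_smoothFun f (t + x)).comp_const_add t x
    have h2 := (hasDerivAt_evolution hH t (t + x)).comp_const_add t x
    have h := h1.mul h2
    convert h using 1
    · rfl
    · simp [shiftOp, LinearMap.funLeft_apply, mulRightEnd, hL, add_mul, mul_assoc]

variable {Λ : ℕ} (H : Fin Λ → ℝ → 𝔸)

/-- The factors of the midpoint step: half a time shift and the exponentials. -/
def stepFactor (l : Fin (Λ + 1)) (y : ℝ) : Module.End ℝ (ℝ → 𝔸) :=
  (Fin.cons (shiftOp 𝔸 y) (fun l => LinearMap.mulRight ℝ fun t =>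
    NormedSpace.exp (y • (-I) • H l t)) : Fin (Λ + 1) → Module.End ℝ (ℝ → 𝔸)) l

/-- The outer half shift moves the exponentials from `t` to the midpoint `t + y / 2`; the inner one
then brings the argument of `f` to `t + y`. -/
theorem palindrome_stepFactor_apply (y : ℝ) (f : ℝ → 𝔸) (t : ℝ) :
    (palindrome fun l => stepFactor H l (y / 2)) f t =
      f (t + y) * midpointStep H (t + y) t := by
  have h1 : (fun l => stepFactor H l (y / 2)) = (Fin.cons (shiftOp 𝔸 (y / 2))
    (fun l => LinearMap.mulRight ℝ fun t => NormedSpace.exp ((y / 2) • (-I) • H l t)) :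
      Fin (Λ + 1) → Module.End ℝ (ℝ → 𝔸)) := rfl
  have he := map_palindrome (Pi.evalMonoidHom (fun _ : ℝ => 𝔸) (t + y / 2))
    (fun l t => NormedSpace.exp ((y / 2) • (-I) • H l t))
  simp only [Pi.evalMonoidHom_apply] at he
  rw [h1, palindrome_cons, palindrome_mulRight]
  simp only [Module.End.mul_apply, shiftOp, LinearMap.funLeft_apply, LinearMap.mulRight_apply,
    Pi.mul_apply, he]
  have h2 : t + y / 2 + y / 2 = t + y := by ring
  rw [h2]
  change _ = _ * palindrome _
  congr 2
  funext l
  rw [neg_I_mul_smul, show (t + y + t) / 2 = t + y / 2 by ring,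
    show (t + y - t) / 2 = y / 2 by ring]

/-- The outermost operator contributes the earliest step as the rightmost factor and shifts the
remaining product by `y`. -/
theorem palindrome_stepFactor_pow (y : ℝ) (n : ℕ) (t : ℝ) :
    ((palindrome fun l => stepFactor H l (y / 2)) ^ n) 1 t =
      ((List.range n).reverse.map fun ℓ : ℕ =>
        midpointStep H (t + ((ℓ : ℝ) + 1) * y) (t + (ℓ : ℝ) * y)).prod := by
  induction n generalizing t with
  | zero => simp
  | succ n ih =>
    rw [pow_succ', Module.End.mul_apply, palindrome_stepFactor_apply, ih, List.range_succ_eq_map,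
      List.reverse_cons, ← List.map_reverse, List.map_append, List.prod_append, List.map_map]
    congr 1
    · congr 2
      funext ℓ
      simp only [Function.comp_apply, Nat.succ_eq_add_one, Nat.cast_add, Nat.cast_one]
      congr 1 <;> ring
    · simp

theorem midpointProd_eq (n : ℕ) (t δ : ℝ) :
    midpointProd H n t δ =
      ((palindrome fun l => stepFactor H l ((n : ℝ)⁻¹ / 2 * δ)) ^ n) 1 t := by
  have h := palindrome_stepFactor_pow H (δ / n) n t
  rw [show (n : ℝ)⁻¹ / 2 * δ = δ / n / 2 by ring, h, midpointProd]
  simp only [mul_div_assoc]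

theorem IsTimeIndependentMPF.isBigO_evolution [CompleteSpace 𝔸] {M : ℕ} {α : Fin M → ℝ}
    {k : Fin M → ℕ} {m : ℕ} (h : IsTimeIndependentMPF α k m) (hH : ∀ l, ContDiff ℝ ∞ (H l))
    {K : Set ℝ} (hK : IsCompact K) :
    (fun p : ℝ × ℝ => evolution (fun r => ∑ l, H l r) (p.1 + p.2) p.1 -
        ∑ j, (α j : ℂ) • midpointProd H (k j) p.1 p.2)
      =O[𝓟 K ×ˢ 𝓝[>] 0] fun p : ℝ × ℝ => p.2 ^ (2 * m + 1) := by
  let L : Fin Λ → smoothFun 𝔸 := fun l =>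
    ⟨fun t => -I • H l t, ((hH l).const_smul (-I) : ContDiff ℝ ∞ fun t => -I • H l t)⟩
  have hc : Continuous fun r => ∑ l, H l r :=
    continuous_finsetSum _ fun l _ => (hH l).continuous
  have hF := opAsymp_evolution hc (∑ l, L l) fun t => by simp [L, Finset.smul_sum]
  -- `d/dt` becomes generator number `0`, the outermost one in the palindrome.
  rw [mulRightEnd_sum, ← Fin.sum_cons] at hF
  have hG : ∀ l (c : ℝ), OpAsymp (fun x => stepFactor H l (c * x)) (expSeries
      (c • (Fin.cons derivEnd fun l => mulRightEnd (L l) : Fin (Λ + 1) → _) l)) := by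
    intro l c
    refine Fin.cases ?_ (fun l => ?_) l
    · exact opAsymp_shiftOp c
    · exact opAsymp_mulRight_exp_smul (L l) c
  have h1 := locO_of_coeff_defectSeries_eq_zero α k hF hG (oneFun 𝔸) (N := 2 * m + 1)
    (fun n hn => h.coeff_defectSeries _ (by omega)) K hK
  refine (h1.mono (prod_mono le_rfl (nhdsWithin_mono _ Set.Ioi_subset_Ici_self))).congr_left ?_
  intro p
  simp [midpointProd_eq, oneFun, shiftOp, LinearMap.funLeft_apply, Complex.coe_smul]

end TimeDependent

end MPF

end

theorem mainTheorem3 {M : ℕ} (α : Fin M → ℝ) (k : Fin M → ℕ) (hk : ∀ j, 0 < k j) (m : ℕ)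
    (hMPF : MPF.IsTimeIndependentMPF α k m)
    {E : Type*} [NormedAddCommGroup E] [InnerProductSpace ℂ E] [FiniteDimensional ℂ E]
    {Λ : ℕ} (H : Fin Λ → ℝ → (E →L[ℂ] E)) (hH : ∀ l, ContDiff ℝ ∞ (H l))
    (K : Set ℝ) (hK : IsCompact K) :
    (fun p : ℝ × ℝ =>
        MPF.evolution (fun r => ∑ l, H l r) (p.1 + p.2) p.1 -
          ∑ j, (α j : ℂ) • MPF.midpointProd H (k j) p.1 p.2)
      =O[𝓟 K ×ˢ 𝓝[>] 0] fun p : ℝ × ℝ => p.2 ^ (2 * m + 1) := by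
  have : CompleteSpace E := FiniteDimensional.complete ℂ E
  exact hMPF.isBigO_evolution H hH hK
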